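/- **Setting.** Terms are built from function symbols with fixed arities and from variables. $\mathcal{V}(t)$ is the set of variables of a term $t$, $|t|_x$ is the number of occurrences of the variable $x$ in $t$, $s|_\pi$ is the subterm of $s$ at position $\pi$, $s[r]_\pi$ is $s$ with this subterm replaced by $r$, and $\mathrm{Pos}_\Sigma(t)$ is the set of positions of $t$ that carry a function symbol. Substitutions have finite domain. A finite multi-distribution is a finite multiset of pairs $(p:a)$ with $0<p\le 1$ whose probabilities sum to $1$. A *probabilistic term rewrite system* (PTRS) $\mathcal{P}$ is a finite set of rules $\ell\to\{p_1:r_1,\dots,p_k:r_k\}$ whose right-hand sides are finite multi-distributions on terms, where $\ell$ is not a variable and $\mathcal{V}(r_j)\subseteq\mathcal{V}(\ell)$ for all $j$. It rewrites $s$ to $\{p_1:s[r_1\sigma]_\pi,\dots,p_k:s[r_k\sigma]_\pi\}$ whenever $s|_\pi=\ell\sigma$ for such a rule, a position $\pi$ of $s$ and a substitution $\sigma$. A *$\mathcal{P}$-rewrite sequence tree* ($\mathcal{P}$-RST) $\mathfrak{T}$ is a finite or infinite, finitely branching rooted tree whose nodes $v$ carry a probability $p_v\in(0,1]$ and a term $t_v$,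 with probability $1$ at the root, such that every node $v$ with children $w_1,\dots,w_k$ ($k\ge 1$) satisfies $t_v\to_{\mathcal{P}}\{\tfrac{p_{w_1}}{p_v}:t_{w_1},\dots,\tfrac{p_{w_k}}{p_v}:t_{w_k}\}$; leaves need not be normal forms. Let $\mathrm{d}(v)$ be the depth of $v$. The height $\mathrm{h}(\mathfrak{T})$ is the supremum of the depths of all nodes. The termination probability is $|\mathfrak{T}|=\sum_{v\in\mathrm{Leaf}(\mathfrak{T})}p_v$, and the expected derivation length is $\mathrm{edl}(\mathfrak{T})=\infty$ if $|\mathfrak{T}|<1$ and $\mathrm{edl}(\mathfrak{T})=\sum_{v\in\mathrm{Leaf}(\mathfrak{T})}\mathrm{d}(v)\,p_v$ otherwise. $\mathcal{P}$ is *AST* if $|\mathfrak{T}|=1$ for all $\mathcal{P}$-RSTs $\mathfrak{T}$, and *PAST* if $\mathrm{edl}(\mathfrak{T})<\infty$ for all $\mathcal{P}$-RSTs $\mathfrak{T}$. A $\mathcal{P}$-RST with root term $t$ is *non-variable-decreasing* if $|t|_x\le|t_v|_x$ for all leaves $v$ and all variables $x$. For terms $t,s$, the term $t$ *occurs* in $s$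 at position $\pi$ if $s|_\pi=t\sigma$ for some substitution $\sigma$. Positions $\pi_1,\pi_2$ are *overlapping* w.r.t. $t$ if $\pi_1=\pi_2.\tau$ or $\pi_2=\pi_1.\tau$ for some $\tau\in\mathrm{Pos}_\Sigma(t)$. Let $\mathrm{maxNO}(t,s)$ be the maximal cardinality of a set of positions of $s$ at each of which $t$ occurs and no two distinct ones of which are overlapping w.r.t. $t$. **Theorem.** Let $\mathcal{P}$ be a PTRS and let $\mathfrak{T}$ be a (finite or infinite) non-variable-decreasing $\mathcal{P}$-RST with $\mathrm{h}(\mathfrak{T})>0$ whose root is labeled by the term $t$ (which need not be linear). The sum below takes values in $[0,\infty]$. 1. If $\sum_{v\in\mathrm{Leaf}(\mathfrak{T})}p_v\cdot\mathrm{maxNO}(t,t_v)>1$, then $\mathcal{P}$ is not AST. 2. If $\sum_{v\in\mathrm{Leaf}(\mathfrak{T})}p_v\cdot\mathrm{maxNO}(t,t_v)\ge 1$, then $\mathcal{P}$ is not PAST. -/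

import Mathlib

open scoped NNReal ENNReal

universe u v w

namespace ProbRewriting

section AbstractRewriting

/-- A finite multi-distribution on `A`: a finite multiset of pairs `(p : a)` with `0 < p ≤ 1`
whose probabilities add up to `1`. -/
structure FDist (A : Type*) where
  pairs : Multiset (ℝ≥0 × A)
  prob_mem : ∀ q ∈ pairs, 0 < q.1 ∧ q.1 ≤ 1
  sum_eq_one : (pairs.map Prod.fst).sum = 1

/-- The support of a multi-distribution, as a multiset of objects. -/
def FDist.supp {A : Type*} (μ : FDist A) : Multiset A := μ.pairs.map Prod.snd

/-- Apply a function to all objects of a multi-distribution. -/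
def FDist.map {A B : Type*} (g : A → B) (μ : FDist A) : FDist B where
  pairs := μ.pairs.map fun q => (q.1, g q.2)
  prob_mem := by
    intro q hq
    obtain ⟨q', hq', rfl⟩ := Multiset.mem_map.1 hq
    exact μ.prob_mem q' hq'
  sum_eq_one := by
    rw [Multiset.map_map]
    exact μ.sum_eq_one

/-- A probabilistic abstract reduction system on `A`: a relation between objects and finite
multi-distributions. -/
abbrev PARS (A : Type*) := A → FDist A → Prop

/-- A (possibly infinite) rewrite sequence tree of a PARS. The nodes are addressed by lists of
natural numbers: the root is `[]`, and the `i`-th child of the node `v` is `i :: v` (so an address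
is read from the node up to the root), for `i < arity v`. The values of `arity`, `prob` and `obj`
on lists that are not nodes are irrelevant. -/
structure RST {A : Type*} (R : PARS A) where
  nodes : Set (List ℕ)
  arity : List ℕ → ℕ
  prob : List ℕ → ℝ≥0
  obj : List ℕ → A
  root_mem : [] ∈ nodes
  cons_mem_iff : ∀ (i : ℕ) (v : List ℕ), i :: v ∈ nodes ↔ v ∈ nodes ∧ i < arity v
  prob_mem : ∀ v ∈ nodes, 0 < prob v ∧ prob v ≤ 1
  prob_root : prob [] = 1
  /-- Every node with at least one child together with its children is a rewrite step. -/
  step : ∀ v ∈ nodes, 0 < arity v → ∃ μ : FDist A, R (obj v) μ ∧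
    μ.pairs = (Multiset.range (arity v)).map fun i => (prob (i :: v) / prob v, obj (i :: v))

namespace RST

variable {A : Type*} {R : PARS A} (T : RST R)

/-- The object at the root. -/
def root : A := T.obj []

/-- The leaves: the nodes without children. -/
def leaves : Set (List ℕ) := {v | v ∈ T.nodes ∧ ∀ i : ℕ, i :: v ∉ T.nodes}

/-- The depth of a node is the length of its address; the height is the supremum of all depths. -/
noncomputable def height : ℕ∞ := ⨆ v : T.nodes, (v.1.length : ℕ∞)

/-- The termination probability `|T|`. -/
noncomputable def termProb : ℝ≥0∞ := ∑' v : T.leaves, (T.prob v : ℝ≥0∞)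

open Classical in
/-- The expected derivation length. -/
noncomputable def edl : ℝ≥0∞ :=
  if T.termProb < 1 then ⊤ else ∑' v : T.leaves, (v.1.length : ℝ≥0∞) * (T.prob v : ℝ≥0∞)

end RST

/-- Almost-sure termination. -/
def IsAST {A : Type*} (R : PARS A) : Prop := ∀ T : RST R, T.termProb = 1

/-- Positive almost-sure termination. -/
def IsPAST {A : Type*} (R : PARS A) : Prop := ∀ T : RST R, T.edl < ⊤

end AbstractRewriting

section Terms

/- Terms over a signature are `L.Term V`, where `L.Functions k` is the set of function symbols of
arity `k` and `V` is the set of variables; the relation symbols of `L` play no role. -/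

variable {L : FirstOrder.Language.{u, v}} {V : Type w}

/-- The set of positions of a term (arguments are numbered from `0`). -/
def positions : L.Term V → Finset (List ℕ)
  | .var _ => {[]}
  | .func _ ts =>
      insert [] (Finset.univ.biUnion fun i => (positions (ts i)).image fun π => i.val :: π)

/-- The subterm at a position; `none` if the list is not a position of the term. -/
def subtermAt : L.Term V → List ℕ → Option (L.Term V)
  | t, [] => some t
  | .var _, _ :: _ => none
  | @FirstOrder.Language.Term.func _ _ l _ ts, i :: π => if h : i < l then subtermAt (ts ⟨i, h⟩) π else none

/-- `replaceAt t π r` is the term obtained from `t` by replacing the subterm at position `π` by `r`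
(and it is `t` if `π` is not a position of `t`). -/
def replaceAt : L.Term V → List ℕ → L.Term V → L.Term V
  | _, [], r => r
  | .var x, _ :: _, _ => .var x
  | .func f ts, i :: π, r => .func f fun j => if j.val = i then replaceAt (ts j) π r else ts j

theorem mem_positions_iff (t : L.Term V) (π : List ℕ) :
    π ∈ positions t ↔ (subtermAt t π).isSome := by
  induction t generalizing π with
  | var x => cases π <;> simp [positions, subtermAt]
  | @func l f ts ih =>
    cases π with
    | nil => simp [positions, subtermAt]
    | cons i π =>
      by_cases h : i < l
      · simp only [positions, subtermAt, h, dif_pos, ← ih]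
        simp only [Finset.mem_insert, Finset.mem_biUnion, Finset.mem_univ, Finset.mem_image,
          true_and, reduceCtorEq, false_or, List.cons.injEq]
        constructor
        · rintro ⟨j, ρ, hρ, rfl, rfl⟩
          exact hρ
        · intro hπ
          exact ⟨⟨i, h⟩, π, hπ, rfl, rfl⟩
      · simp only [positions, subtermAt, h, dif_neg, not_false_eq_true, Option.isSome_none,
          Bool.false_eq_true, iff_false]
        simp only [Finset.mem_insert, Finset.mem_biUnion, Finset.mem_univ, Finset.mem_image,
          true_and, reduceCtorEq, false_or, List.cons.injEq]
        rintro ⟨j, ρ, -, rfl, -⟩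
        exact h j.isLt

/-- `π` is a position of `t` that carries a function symbol. -/
def IsFunPos (t : L.Term V) (π : List ℕ) : Prop :=
  ∃ (l : ℕ) (f : L.Functions l) (ts : Fin l → L.Term V), subtermAt t π = some (.func f ts)

open Classical in
/-- The number of occurrences of the variable `x` in a term. -/
noncomputable def varCount (x : V) : L.Term V → ℕ
  | .var y => if y = x then 1 else 0
  | .func _ ts => ∑ i, varCount x (ts i)

/-- A substitution is a map from variables to terms with finite domain. -/
def IsSubst (σ : V → L.Term V) : Prop := {x | σ x ≠ .var x}.Finite

/-- The term `t` occurs in `s` at the position `π`. -/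
def OccursAt (t s : L.Term V) (π : List ℕ) : Prop :=
  ∃ σ : V → L.Term V, IsSubst σ ∧ subtermAt s π = some (t.subst σ)

/-- Two positions are overlapping w.r.t. `t`. -/
def Overlapping (t : L.Term V) (π₁ π₂ : List ℕ) : Prop :=
  ∃ τ : List ℕ, IsFunPos t τ ∧ (π₁ = π₂ ++ τ ∨ π₂ = π₁ ++ τ)

/-- The sets of pairwise non-overlapping occurrences of `t` in `s`. -/
def NO (t s : L.Term V) : Set (Finset (List ℕ)) :=
  {S | S ⊆ positions s ∧ (∀ π ∈ S, OccursAt t s π) ∧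
    ∀ π₁ ∈ S, ∀ π₂ ∈ S, π₁ ≠ π₂ → ¬ Overlapping t π₁ π₂}

open Classical in
/-- The maximal number of pairwise non-overlapping occurrences of `t` in `s`. -/
noncomputable def maxNO (t s : L.Term V) : ℕ :=
  ((positions s).powerset.filter fun S => S ∈ NO t s).sup Finset.card

theorem isGreatest_maxNO (t s : L.Term V) :
    IsGreatest (Finset.card '' NO t s) (maxNO t s) := by
  classical
  constructor
  · have hne : ((positions s).powerset.filter fun S => S ∈ NO t s).Nonempty :=
      ⟨∅, Finset.mem_filter.2 ⟨Finset.empty_mem_powerset _, by simp [NO]⟩⟩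
    obtain ⟨S, hS, h⟩ := Finset.exists_mem_eq_sup _ hne Finset.card
    refine ⟨S, (Finset.mem_filter.1 hS).2, ?_⟩
    rw [maxNO, ← h]
  · rintro _ ⟨S, hS, rfl⟩
    exact Finset.le_sup (f := Finset.card)
      (Finset.mem_filter.2 ⟨Finset.mem_powerset.2 hS.1, hS⟩)

variable (L V) in
open Classical in
/-- A probabilistic term rewrite rule. -/
structure ProbRule where
  lhs : L.Term V
  rhs : FDist (L.Term V)
  lhs_ne_var : ∀ x : V, lhs ≠ .var x
  vars_subset : ∀ r ∈ rhs.supp, r.varFinset ⊆ lhs.varFinset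

variable (L V) in
/-- A probabilistic term rewrite system: a finite set of probabilistic rewrite rules. -/
structure PTRS where
  rules : Set (ProbRule L V)
  finite_rules : rules.Finite

/-- The rewrite relation of a PTRS, as a PARS on terms. -/
def PTRS.rewrites (P : PTRS L V) : PARS (L.Term V) := fun s μ =>
  ∃ π ∈ positions s, ∃ ρ ∈ P.rules, ∃ σ : V → L.Term V, IsSubst σ ∧
    subtermAt s π = some (ρ.lhs.subst σ) ∧
    μ = ρ.rhs.map fun r => replaceAt s π (r.subst σ)

/-- A rewrite sequence tree of a PTRS is non-variable-decreasing if no variable occurs more often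
in the root than in some leaf. -/
def IsNVD {P : PTRS L V} (T : RST P.rewrites) : Prop :=
  ∀ v ∈ T.leaves, ∀ x : V, varCount x T.root ≤ varCount x (T.obj v)

end Terms

end ProbRewriting

/-! Wherever `t` occurs in a term, the whole tree can be replayed at that occurrence, since
rewriting is closed under contexts and substitutions. Keep a counter that bounds `maxNO t` of the
current term from below. A replay ending in the leaf `v` consumes one occurrence and supplies `maxNO
t (T.obj v)` new ones, so the counter performs a branching walk with offspring `X v`, stopped at
`0`; the hypotheses say that its mean offspring is above, or at least, one.

Combinatorial core (`exists_occurrence_replaceAt`): replace the shortest position of a maximum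
non-overlapping set. The others are parallel to it, hence untouched, or lie inside the substitution.
The latter are re-created because no variable occurs less often in the leaf than in `t`.

Probabilistic core: with `gen z` the generating function of the offspring, `z ^ counter` is
superharmonic as soon as `gen z ≤ z`. A mean above one provides such a `z < 1`, and the termination
probability is at most `z`. For a mean of at least one, `gen z ≤ z + (1 - z) * c` holds for any
small `c` and a suitable `z < 1`. The drift is then so small that a finite expected length is
contradictory. -/

namespace ProbRewriting

/-! ### Superharmonic functions on rewrite sequence trees -/

namespace RST

variable {A : Type*} {R : PARS A} (T : RST R)

theorem mem_leaves_iff {v : List ℕ} : v ∈ T.leaves ↔ v ∈ T.nodes ∧ T.arity v = 0 := by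
  constructor
  · rintro ⟨hv, h⟩
    refine ⟨hv, Nat.eq_zero_of_not_pos fun hpos => h 0 ?_⟩
    exact (T.cons_mem_iff 0 v).2 ⟨hv, hpos⟩
  · rintro ⟨hv, h⟩
    refine ⟨hv, fun i hi => ?_⟩
    have := ((T.cons_mem_iff i v).1 hi).2
    omega

theorem mem_nodes_of_suffix {v w : List ℕ} (h : v <:+ w) (hw : w ∈ T.nodes) : v ∈ T.nodes := by
  obtain ⟨l, rfl⟩ := h
  induction l with
  | nil => exact hw
  | cons i l ih => exact ih ((T.cons_mem_iff i _).1 hw).1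

theorem suffix_iff_eq_of_mem_leaves {v w : List ℕ} (hv : v ∈ T.leaves) (hw : w ∈ T.leaves) :
    v <:+ w ↔ w = v := by
  constructor
  · intro h
    obtain ⟨l, rfl⟩ := h
    rcases List.eq_nil_or_concat l with rfl | ⟨l', i, rfl⟩
    · rfl
    · exfalso
      refine hv.2 i (T.mem_nodes_of_suffix ?_ hw.1)
      exact ⟨l', by simp⟩
  · rintro rfl
    exact List.suffix_rfl

/-- Ancestors are suffixes of an address, and a leaf below an inner node is below exactly one of its
children. -/
theorem sum_ite_cons_suffix {v w : List ℕ} (ha : 0 < T.arity v)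
    (hw : w ∈ T.leaves) (c : ℝ≥0∞) :
    (if v <:+ w then c else 0) =
      ∑ i ∈ Finset.range (T.arity v), if i :: v <:+ w then c else 0 := by
  split_ifs with h
  · obtain ⟨l, rfl⟩ := h
    rcases List.eq_nil_or_concat l with rfl | ⟨l', j, rfl⟩
    · have := (T.mem_leaves_iff.1 hw).2
      simp only [List.nil_append] at this
      omega
    · have hj : j :: v <:+ l'.concat j ++ v := ⟨l', by simp⟩
      have hjm := (T.cons_mem_iff j v).1 (T.mem_nodes_of_suffix hj hw.1)
      rw [Finset.sum_eq_single j]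
      · rw [if_pos hj]
      · intro i _ hij
        refine if_neg fun hi => hij ?_
        have := (List.suffix_of_suffix_length_le hi hj (by simp)).eq_of_length (by simp)
        exact (List.cons.inj this).1
      · intro hj'
        exact absurd (Finset.mem_range.2 hjm.2) hj'
  · refine (Finset.sum_eq_zero fun i _ => if_neg fun hi => h ?_).symm
    exact (List.suffix_cons i v).trans hi

theorem sum_prob_children {v : List ℕ} (hv : v ∈ T.nodes) (ha : 0 < T.arity v) :
    ∑ i ∈ Finset.range (T.arity v), (T.prob (i :: v) : ℝ≥0∞) = T.prob v := by
  obtain ⟨μ, -, hμ⟩ := T.step v hv ha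
  have h := μ.sum_eq_one
  rw [hμ, Multiset.map_map] at h
  have h' : ∑ i ∈ Finset.range (T.arity v), T.prob (i :: v) / T.prob v = 1 := h
  rw [← Finset.sum_div, div_eq_one_iff_eq (T.prob_mem v hv).1.ne'] at h'
  exact_mod_cast h'

/-- The sum of `g` over all leaves that are below the node `v` or equal to it. -/
noncomputable def leafSum (g : List ℕ → ℝ≥0∞) (v : List ℕ) : ℝ≥0∞ :=
  ∑' w : T.leaves, if v <:+ w.1 then g w.1 else 0

theorem leafSum_nil (g : List ℕ → ℝ≥0∞) : T.leafSum g [] = ∑' w : T.leaves, g w.1 := by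
  simp [leafSum]

theorem leafSum_leaf (g : List ℕ → ℝ≥0∞) {v : List ℕ} (hv : v ∈ T.leaves) :
    T.leafSum g v = g v := by
  have h : ∀ w : T.leaves, (if v <:+ w.1 then g w.1 else 0) = if w = ⟨v, hv⟩ then g v else 0 := by
    intro w
    by_cases hw : w.1 = v
    · rw [if_pos ((T.suffix_iff_eq_of_mem_leaves hv w.2).2 hw), if_pos (Subtype.ext hw), hw]
    · rw [if_neg (mt (T.suffix_iff_eq_of_mem_leaves hv w.2).1 hw),
        if_neg fun h => hw (congrArg Subtype.val h)]
  rw [leafSum, tsum_congr h, tsum_ite_eq]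

theorem leafSum_eq_sum (g : List ℕ → ℝ≥0∞) {v : List ℕ} (ha : 0 < T.arity v) :
    T.leafSum g v = ∑ i ∈ Finset.range (T.arity v), T.leafSum g (i :: v) := by
  unfold leafSum
  rw [← Summable.tsum_finsetSum fun _ _ => ENNReal.summable]
  exact tsum_congr fun w => T.sum_ite_cons_suffix ha w.2 _

/-- A function on the nodes that is superharmonic dominates the leaf sums of its boundary values. -/
theorem leafSum_le {g F : List ℕ → ℝ≥0∞}
    (hF : ∀ v ∈ T.nodes, 0 < T.arity v →
      ∑ i ∈ Finset.range (T.arity v), F (i :: v) ≤ F v)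
    (hg : ∀ v ∈ T.leaves, g v ≤ F v) {v : List ℕ} (hv : v ∈ T.nodes) :
    T.leafSum g v ≤ F v := by
  rw [leafSum, ENNReal.tsum_eq_iSup_sum]
  refine iSup_le fun s => ?_
  -- The tree may be infinite, but the finite set `s` of leaves has bounded depth; the induction is
  -- on the number `k` of levels left below `v`.
  have key : ∀ (k : ℕ) (v : List ℕ), v ∈ T.nodes → (∀ w ∈ s, w.1.length ≤ v.length + k) →
      ∑ w ∈ s, (if v <:+ w.1 then g w.1 else 0) ≤ F v := by
    intro k
    induction k with
    | zero =>
      intro v hv hs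
      by_cases ha : 0 < T.arity v
      · rw [Finset.sum_eq_zero]
        · exact zero_le
        · intro w hw
          refine if_neg fun h => ?_
          have hvw : v = w.1 := h.eq_of_length_le (hs w hw)
          have := (T.mem_leaves_iff.1 w.2).2
          rw [← hvw] at this
          omega
      · have hl : v ∈ T.leaves := T.mem_leaves_iff.2 ⟨hv, by omega⟩
        refine le_trans (ENNReal.sum_le_tsum s) ?_
        exact (T.leafSum_leaf g hl).le.trans (hg v hl)
    | succ k ih =>
      intro v hv hs
      by_cases ha : 0 < T.arity v
      · rw [Finset.sum_congr rfl fun w _ => T.sum_ite_cons_suffix ha w.2 (g w.1),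
          Finset.sum_comm]
        refine le_trans (Finset.sum_le_sum fun i hi => ?_) (hF v hv ha)
        refine ih (i :: v) ((T.cons_mem_iff i v).2 ⟨hv, Finset.mem_range.1 hi⟩) fun w hw => ?_
        have := hs w hw
        simp only [List.length_cons]
        omega
      · have hl : v ∈ T.leaves := T.mem_leaves_iff.2 ⟨hv, by omega⟩
        refine le_trans (ENNReal.sum_le_tsum s) ?_
        exact (T.leafSum_leaf g hl).le.trans (hg v hl)
  refine key (s.sup fun w => w.1.length) v hv fun w hw => ?_
  have : w.1.length ≤ s.sup fun w => w.1.length :=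
    Finset.le_sup (f := fun w : T.leaves => w.1.length) hw
  omega

theorem leafSum_prob_le {v : List ℕ} (hv : v ∈ T.nodes) :
    T.leafSum (fun w => T.prob w) v ≤ T.prob v :=
  T.leafSum_le (F := fun w => (T.prob w : ℝ≥0∞))
    (fun _ hv ha => (T.sum_prob_children hv ha).le) (fun _ _ => le_rfl) hv

theorem termProb_eq_leafSum : T.termProb = T.leafSum (fun w => T.prob w) [] := by
  rw [leafSum_nil]
  rfl

theorem termProb_le_one : T.termProb ≤ 1 := by
  rw [termProb_eq_leafSum]
  refine (T.leafSum_prob_le T.root_mem).trans ?_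
  simp [T.prob_root]

/-- Mass lost below one child could not be made up by its siblings, whose leaf sums are at most
their probabilities; so equality at the root descends to every node. -/
theorem leafSum_prob_eq (h : 1 ≤ T.termProb) {v : List ℕ} (hv : v ∈ T.nodes) :
    T.leafSum (fun w => T.prob w) v = T.prob v := by
  refine le_antisymm (T.leafSum_prob_le hv) ?_
  induction v with
  | nil => simpa [T.prob_root, termProb_eq_leafSum] using h
  | cons i v ih =>
    obtain ⟨hv', hi⟩ := (T.cons_mem_iff i v).1 hv
    have ha : 0 < T.arity v := by omega
    have h1 := ih hv'
    rw [T.leafSum_eq_sum _ ha, ← T.sum_prob_children hv' ha,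
      ← Finset.add_sum_erase _ _ (Finset.mem_range.2 hi),
      ← Finset.add_sum_erase _ _ (Finset.mem_range.2 hi)] at h1
    have h2 : ∑ j ∈ (Finset.range (T.arity v)).erase i, T.leafSum (fun w => T.prob w) (j :: v) ≤
        ∑ j ∈ (Finset.range (T.arity v)).erase i, (T.prob (j :: v) : ℝ≥0∞) :=
      Finset.sum_le_sum fun j hj => T.leafSum_prob_le
        ((T.cons_mem_iff j v).2 ⟨hv', Finset.mem_range.1 (Finset.mem_of_mem_erase hj)⟩)
    have hfin : ∑ j ∈ (Finset.range (T.arity v)).erase i, (T.prob (j :: v) : ℝ≥0∞) ≠ ⊤ :=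
      ENNReal.sum_ne_top.2 fun _ _ => ENNReal.coe_ne_top
    exact ENNReal.le_of_add_le_add_right hfin (h1.trans (by gcongr))

/-- If the expectation of `F` grows by at most `ε` in every step and `F` is at least `1` at the
leaves (everything weighted by probabilities), then an almost surely terminating tree needs long
derivations. -/
theorem one_le_add_mul_sum_length (hT : 1 ≤ T.termProb) {F : List ℕ → ℝ≥0∞} {ε : ℝ≥0∞}
    (hF : ∀ v ∈ T.nodes, 0 < T.arity v →
      ∑ i ∈ Finset.range (T.arity v), F (i :: v) ≤ F v + ε * T.prob v)
    (hl : ∀ v ∈ T.leaves, (T.prob v : ℝ≥0∞) ≤ F v) :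
    1 ≤ F [] + ε * ∑' v : T.leaves, (v.1.length : ℝ≥0∞) * (T.prob v : ℝ≥0∞) := by
  -- `J v` is the expected number of remaining steps, weighted by the probability of `v`. It drops
  -- by `T.prob v` in each step, which makes `F + ε * J` superharmonic.
  let J : List ℕ → ℝ≥0∞ := fun v =>
    T.leafSum (fun w => ((w.length - v.length : ℕ) : ℝ≥0∞) * T.prob w) v
  have hJ : ∀ v ∈ T.nodes, 0 < T.arity v →
      ∑ i ∈ Finset.range (T.arity v), J (i :: v) + T.prob v = J v := by
    intro v hv ha
    simp only [J]
    rw [T.leafSum_eq_sum _ ha, ← T.leafSum_prob_eq hT hv, T.leafSum_eq_sum _ ha,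
      ← Finset.sum_add_distrib]
    refine Finset.sum_congr rfl fun i _ => ?_
    unfold leafSum
    rw [← ENNReal.tsum_add]
    refine tsum_congr fun w => ?_
    split_ifs with h
    · have hlen := h.length_le
      simp only [List.length_cons] at hlen ⊢
      rw [show w.1.length - v.length = (w.1.length - (v.length + 1)) + 1 by omega]
      push_cast
      ring
    · simp
  have h := T.leafSum_le (g := fun w => T.prob w) (F := fun v => F v + ε * J v) ?_ ?_ T.root_mem
  · rw [← termProb_eq_leafSum] at h
    refine hT.trans (h.trans (le_of_eq ?_))
    simp only [J]
    rw [T.leafSum_nil]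
    simp
  · intro v hv ha
    rw [Finset.sum_add_distrib, ← Finset.mul_sum, ← hJ v hv ha]
    refine (add_le_add_left (hF v hv ha) _).trans (le_of_eq ?_)
    ring
  · intro v hv
    exact (hl v hv).trans le_self_add

theorem not_isPAST_of_termProb_lt (h : T.termProb < 1) : ¬ IsPAST R := fun hP => by
  have := hP T
  simp [edl, h] at this

end RST

/-! ### Trees generated by a strategy -/

/-- A deterministic strategy with states in `Q` for building a rewrite sequence tree of `R`. -/
structure Strategy {A : Type*} (R : PARS A) (Q : Type*) where
  obj : Q → A
  arity : Q → ℕ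
  child : Q → ℕ → Q
  prob : Q → ℕ → ℝ≥0
  inv : Q → Prop
  start : Q
  inv_start : inv start
  inv_child : ∀ q i, inv q → i < arity q → inv (child q i)
  prob_mem : ∀ q i, inv q → i < arity q → 0 < prob q i ∧ prob q i ≤ 1
  step : ∀ q, inv q → 0 < arity q → ∃ μ : FDist A, R (obj q) μ ∧
    μ.pairs = (Multiset.range (arity q)).map fun i => (prob q i, obj (child q i))

namespace Strategy

variable {A : Type*} {R : PARS A} {Q : Type*} (S : Strategy R Q)

def stateAt : List ℕ → Q
  | [] => S.start
  | i :: v => S.child (stateAt v) i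

def probAt : List ℕ → ℝ≥0
  | [] => 1
  | i :: v => probAt v * S.prob (S.stateAt v) i

def IsNode : List ℕ → Prop
  | [] => True
  | i :: v => IsNode v ∧ i < S.arity (S.stateAt v)

variable {S} in
theorem IsNode.inv {v : List ℕ} (hv : S.IsNode v) : S.inv (S.stateAt v) := by
  induction v with
  | nil => exact S.inv_start
  | cons i v ih => exact S.inv_child _ _ (ih hv.1) hv.2

variable {S} in
theorem IsNode.probAt_mem {v : List ℕ} (hv : S.IsNode v) : 0 < S.probAt v ∧ S.probAt v ≤ 1 := by
  induction v with
  | nil => simp [probAt]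
  | cons i v ih =>
    have h1 := ih hv.1
    have h2 := S.prob_mem _ i hv.1.inv hv.2
    exact ⟨mul_pos h1.1 h2.1, mul_le_one' h1.2 h2.2⟩

/-- The rewrite sequence tree built by a strategy. -/
def tree : RST R where
  nodes := {v | S.IsNode v}
  arity v := S.arity (S.stateAt v)
  prob := S.probAt
  obj v := S.obj (S.stateAt v)
  root_mem := trivial
  cons_mem_iff _ _ := Iff.rfl
  prob_mem _ hv := hv.probAt_mem
  prob_root := rfl
  step v hv ha := by
    obtain ⟨μ, h, hμ⟩ := S.step _ hv.inv ha
    refine ⟨μ, h, hμ.trans (Multiset.map_congr rfl fun i _ => ?_)⟩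
    simp only [probAt, stateAt]
    rw [mul_div_cancel_left₀ _ hv.probAt_mem.1.ne']

/-- Weighting the one-step bound on states by the probability of the node turns it into the
superharmonicity condition on the tree, with drift `ε * prob`. -/
theorem sum_tree_prob_mul_le {val : Q → ℝ≥0∞} {ε : ℝ≥0∞}
    (hval : ∀ q, S.inv q → 0 < S.arity q →
      ∑ i ∈ Finset.range (S.arity q), (S.prob q i : ℝ≥0∞) * val (S.child q i) ≤ val q + ε)
    {v : List ℕ} (hv : v ∈ S.tree.nodes) (ha : 0 < S.tree.arity v) :
    ∑ i ∈ Finset.range (S.tree.arity v), (S.tree.prob (i :: v) : ℝ≥0∞) * val (S.stateAt (i :: v)) ≤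
      S.tree.prob v * val (S.stateAt v) + ε * S.tree.prob v := by
  have h := mul_le_mul_right (hval _ (IsNode.inv hv) ha) (S.probAt v : ℝ≥0∞)
  rw [Finset.mul_sum] at h
  refine le_trans (le_of_eq ?_) (h.trans (le_of_eq ?_))
  · refine Finset.sum_congr rfl fun i _ => ?_
    change ((S.probAt v * S.prob (S.stateAt v) i : ℝ≥0) : ℝ≥0∞) * val (S.child (S.stateAt v) i) = _
    push_cast
    ring
  · change _ = (S.probAt v : ℝ≥0∞) * val (S.stateAt v) + ε * (S.probAt v : ℝ≥0∞)
    ring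

theorem le_tree_prob_mul {val : Q → ℝ≥0∞} (hval : ∀ q, S.inv q → S.arity q = 0 → 1 ≤ val q)
    {v : List ℕ} (hv : v ∈ S.tree.leaves) :
    (S.tree.prob v : ℝ≥0∞) ≤ S.tree.prob v * val (S.stateAt v) := by
  obtain ⟨hv, ha⟩ := S.tree.mem_leaves_iff.1 hv
  exact le_mul_of_one_le_right' (hval _ (IsNode.inv hv) ha)

theorem termProb_tree_le {val : Q → ℝ≥0∞}
    (hval : ∀ q, S.inv q → 0 < S.arity q →
      ∑ i ∈ Finset.range (S.arity q), (S.prob q i : ℝ≥0∞) * val (S.child q i) ≤ val q)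
    (hleaf : ∀ q, S.inv q → S.arity q = 0 → 1 ≤ val q) :
    S.tree.termProb ≤ val S.start := by
  rw [RST.termProb_eq_leafSum]
  refine (S.tree.leafSum_le (F := fun v => S.tree.prob v * val (S.stateAt v))
    (fun v hv ha => ?_) (fun v hv => S.le_tree_prob_mul hleaf hv) S.tree.root_mem).trans ?_
  · simpa using S.sum_tree_prob_mul_le (ε := 0) (by simpa using hval) hv ha
  · simp [S.tree.prob_root, stateAt]

theorem one_le_add_mul_tree_length (hT : 1 ≤ S.tree.termProb) {val : Q → ℝ≥0∞} {ε : ℝ≥0∞}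
    (hval : ∀ q, S.inv q → 0 < S.arity q →
      ∑ i ∈ Finset.range (S.arity q), (S.prob q i : ℝ≥0∞) * val (S.child q i) ≤ val q + ε)
    (hleaf : ∀ q, S.inv q → S.arity q = 0 → 1 ≤ val q) :
    1 ≤ val S.start +
      ε * ∑' v : S.tree.leaves, (v.1.length : ℝ≥0∞) * (S.tree.prob v : ℝ≥0∞) := by
  have h := S.tree.one_le_add_mul_sum_length hT
    (F := fun v => S.tree.prob v * val (S.stateAt v))
    (fun v hv ha => S.sum_tree_prob_mul_le hval hv ha) (fun v hv => S.le_tree_prob_mul hleaf hv)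
  simpa [S.tree.prob_root, stateAt] using h

end Strategy

/-! ### Replaying a tree as a branching walk -/

section Iterate

variable {A : Type*} {R : PARS A}

/-- `e` maps rewrite steps to rewrite steps. -/
def Compatible (R : PARS A) (e : A → A) : Prop := ∀ a μ, R a μ → R (e a) (μ.map e)

/-- The tree `T` can be replayed inside every object that is good for a positive number, and the
leaf `v` of the replayed tree contributes `X v` to this number. -/
def Replayable (T : RST R) (X : List ℕ → ℕ) (Good : ℕ → A → Prop) (n : ℕ) (a : A)
    (e : A → A) : Prop :=
  Compatible R e ∧ e T.root = a ∧ ∀ v ∈ T.leaves, Good (n + X v) (e (T.obj v))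

namespace Replay

variable (T : RST R) (X : List ℕ → ℕ) (emb : ℕ → A → A → A)

/-- A state `(n, a, v)` consists of the counter, the object in which the current replay started and
the node of `T` reached so far. -/
def obj : ℕ × A × List ℕ → A
  | (0, a, _) => a
  | (n + 1, a, v) => emb n a (T.obj v)

def arity : ℕ × A × List ℕ → ℕ
  | (0, _, _) => 0
  | (_ + 1, _, v) => T.arity v

/-- Arriving at a leaf of `T` opens the next replay at once, so that `v` is always an inner node and
no step is spent on the restart. -/
def child : ℕ × A × List ℕ → ℕ → ℕ × A × List ℕ
  | (0, a, v), _ => (0, a, v)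
  | (n + 1, a, v), i =>
    if T.arity (i :: v) = 0 then (n + X (i :: v), emb n a (T.obj (i :: v)), [])
    else (n + 1, a, i :: v)

noncomputable def prob : ℕ × A × List ℕ → ℕ → ℝ≥0 := fun q i =>
  T.prob (i :: q.2.2) / T.prob q.2.2

def inv (Good : ℕ → A → Prop) : ℕ × A × List ℕ → Prop := fun q =>
  Good q.1 q.2.1 ∧ q.2.2 ∈ T.nodes ∧ 0 < T.arity q.2.2

theorem prob_div_le {v : List ℕ} {i : ℕ} (hv : v ∈ T.nodes) (hi : i < T.arity v) :
    0 < T.prob (i :: v) / T.prob v ∧ T.prob (i :: v) / T.prob v ≤ 1 := by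
  obtain ⟨μ, -, hμ⟩ := T.step v hv (by omega)
  refine μ.prob_mem (T.prob (i :: v) / T.prob v, T.obj (i :: v)) ?_
  rw [hμ]
  exact Multiset.mem_map_of_mem _ (Multiset.mem_range.2 hi)

/-- The strategy that replays `T` again and again until the counter is `0`. -/
noncomputable def strategy (Good : ℕ → A → Prop) (hroot : 0 < T.arity [])
    (hemb : ∀ n a, Good (n + 1) a → Replayable T X Good n a (emb n a))
    (hgood : Good 1 T.root) : Strategy R (ℕ × A × List ℕ) where
  obj := obj T emb
  arity := arity T
  child := child T X emb
  prob := prob T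
  inv := inv T Good
  start := (1, T.root, [])
  inv_start := ⟨hgood, T.root_mem, hroot⟩
  inv_child := by
    rintro ⟨_ | n, a, v⟩ i ⟨hg, hv, ha⟩ hi
    · simp [arity] at hi
    · have hiv : i :: v ∈ T.nodes := (T.cons_mem_iff i v).2 ⟨hv, hi⟩
      simp only [child]
      split_ifs with h
      · exact ⟨(hemb n a hg).2.2 _ (T.mem_leaves_iff.2 ⟨hiv, h⟩), T.root_mem, hroot⟩
      · exact ⟨hg, hiv, Nat.pos_of_ne_zero h⟩
  prob_mem := by
    rintro ⟨_ | n, a, v⟩ i ⟨hg, hv, ha⟩ hi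
    · simp [arity] at hi
    · exact prob_div_le T hv hi
  step := by
    rintro ⟨_ | n, a, v⟩ ⟨hg, hv, -⟩ ha
    · simp [arity] at ha
    · obtain ⟨μ, hR, hμ⟩ := T.step v hv ha
      refine ⟨μ.map (emb n a), (hemb n a hg).1 _ _ hR, ?_⟩
      simp only [FDist.map, hμ, Multiset.map_map]
      refine Multiset.map_congr rfl fun i hi => ?_
      simp only [Function.comp, prob, child, Prod.mk.injEq, true_and]
      split_ifs with h
      -- The restarted state shows the embedded root of `T`, which is the object just reached by
      -- `Replayable`; with counter `0` the object itself is shown.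
      · rcases hm : n + X (i :: v) with _ | m
        · rfl
        · have hiv : i :: v ∈ T.nodes := (T.cons_mem_iff i v).2 ⟨hv, Multiset.mem_range.1 hi⟩
          have hg' := (hemb n a hg).2.2 _ (T.mem_leaves_iff.2 ⟨hiv, h⟩)
          rw [hm] at hg'
          exact (hemb m _ hg').2.1.symm
      · rfl

/-- The generating function of the leaf weights. -/
noncomputable def gen (z : ℝ≥0) : ℝ≥0∞ := ∑' v : T.leaves, (T.prob v : ℝ≥0∞) * (z : ℝ≥0∞) ^ X v

/-- The expectation of `z ^ counter` at the end of the current replay, given that it has reached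
`v`; replays that never end contribute nothing. -/
noncomputable def val (z : ℝ≥0) : ℕ × A × List ℕ → ℝ≥0∞
  | (0, _, _) => 1
  | (n + 1, _, v) =>
    (z : ℝ≥0∞) ^ n * (T.leafSum (fun w => (T.prob w : ℝ≥0∞) * (z : ℝ≥0∞) ^ X w) v / T.prob v)

theorem val_nil_le {z : ℝ≥0} (hz : z ≤ 1) {ε : ℝ≥0∞} (h : gen T X z ≤ z + ε) (n : ℕ) (a : A) :
    val T X z (n, a, []) ≤ (z : ℝ≥0∞) ^ n + ε := by
  rcases n with _ | n
  · simp [val]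
  · simp only [val, T.prob_root, ENNReal.coe_one, div_one, T.leafSum_nil]
    have hz' : (z : ℝ≥0∞) ^ n ≤ 1 := pow_le_one' (by exact_mod_cast hz) n
    calc (z : ℝ≥0∞) ^ n * gen T X z ≤ (z : ℝ≥0∞) ^ n * (z + ε) := by gcongr
      _ = (z : ℝ≥0∞) ^ (n + 1) + (z : ℝ≥0∞) ^ n * ε := by ring
      _ ≤ (z : ℝ≥0∞) ^ (n + 1) + 1 * ε := by gcongr
      _ = _ := by rw [one_mul]

/-- Inside a replay `val` is harmonic, being a conditional expectation. Only a restart can increase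
it, and by at most `ε` because of `val_nil_le`. -/
theorem sum_prob_mul_val_le {z : ℝ≥0} (hz : z ≤ 1) {ε : ℝ≥0∞} (h : gen T X z ≤ z + ε)
    (Good : ℕ → A → Prop) (q : ℕ × A × List ℕ) (hq : inv T Good q) (ha : 0 < arity T q) :
    ∑ i ∈ Finset.range (arity T q), (prob T q i : ℝ≥0∞) * val T X z (child T X emb q i) ≤
      val T X z q + ε := by
  rcases q with ⟨_ | n, a, v⟩
  · simp [arity] at ha
  obtain ⟨-, hv, -⟩ := hq
  dsimp only at hv
  change 0 < T.arity v at ha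
  set H := T.leafSum (fun w => (T.prob w : ℝ≥0∞) * (z : ℝ≥0∞) ^ X w) with hH
  have hp0 : ∀ w ∈ T.nodes, (T.prob w : ℝ≥0∞) ≠ 0 := fun w hw => by
    exact_mod_cast (T.prob_mem w hw).1.ne'
  have hchild : ∀ i ∈ Finset.range (T.arity v),
      val T X z (child T X emb (n + 1, a, v) i) ≤
        (z : ℝ≥0∞) ^ n * (H (i :: v) / T.prob (i :: v)) + ε := by
    intro i hi
    have hiv : i :: v ∈ T.nodes := (T.cons_mem_iff i v).2 ⟨hv, Finset.mem_range.1 hi⟩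
    simp only [child]
    split_ifs with h0
    · refine (val_nil_le T X hz h _ _).trans (le_of_eq ?_)
      rw [hH, T.leafSum_leaf _ (T.mem_leaves_iff.2 ⟨hiv, h0⟩), pow_add,
        ENNReal.mul_div_right_comm, ENNReal.div_self (hp0 _ hiv) ENNReal.coe_ne_top, one_mul]
    · exact le_self_add
  have hprob : ∀ i, (prob T (n + 1, a, v) i : ℝ≥0∞) = (T.prob (i :: v) : ℝ≥0∞) / T.prob v := by
    intro i
    simp only [prob]
    rw [ENNReal.coe_div (T.prob_mem v hv).1.ne']
  calc ∑ i ∈ Finset.range (T.arity v),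
        (prob T (n + 1, a, v) i : ℝ≥0∞) * val T X z (child T X emb (n + 1, a, v) i)
      ≤ ∑ i ∈ Finset.range (T.arity v), ((T.prob (i :: v) : ℝ≥0∞) / T.prob v) *
          ((z : ℝ≥0∞) ^ n * (H (i :: v) / T.prob (i :: v)) + ε) := by
        refine Finset.sum_le_sum fun i hi => ?_
        rw [hprob]
        gcongr
        exact hchild i hi
    _ = ∑ i ∈ Finset.range (T.arity v), ((z : ℝ≥0∞) ^ n * (T.prob v : ℝ≥0∞)⁻¹ * H (i :: v) +
          (ε * (T.prob v : ℝ≥0∞)⁻¹) * T.prob (i :: v)) := by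
        refine Finset.sum_congr rfl fun i hi => ?_
        have hiv : i :: v ∈ T.nodes := (T.cons_mem_iff i v).2 ⟨hv, Finset.mem_range.1 hi⟩
        have hc : (T.prob (i :: v) : ℝ≥0∞) * (T.prob (i :: v) : ℝ≥0∞)⁻¹ = 1 :=
          ENNReal.mul_inv_cancel (hp0 _ hiv) ENNReal.coe_ne_top
        simp only [div_eq_mul_inv]
        calc _ = (z : ℝ≥0∞) ^ n * (T.prob v : ℝ≥0∞)⁻¹ * H (i :: v) *
              ((T.prob (i :: v) : ℝ≥0∞) * (T.prob (i :: v) : ℝ≥0∞)⁻¹) +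
              (ε * (T.prob v : ℝ≥0∞)⁻¹) * T.prob (i :: v) := by ring
          _ = _ := by rw [hc, mul_one]
    _ = (z : ℝ≥0∞) ^ n * (H v / T.prob v) + ε := by
        rw [Finset.sum_add_distrib, ← Finset.mul_sum, ← Finset.mul_sum, T.sum_prob_children hv ha,
          mul_assoc ε, ENNReal.inv_mul_cancel (hp0 _ hv) ENNReal.coe_ne_top, hH,
          T.leafSum_eq_sum _ ha, mul_one, div_eq_mul_inv]
        ring

theorem one_le_val (z : ℝ≥0) (Good : ℕ → A → Prop) (q : ℕ × A × List ℕ) (hq : inv T Good q)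
    (ha : arity T q = 0) : 1 ≤ val T X z q := by
  rcases q with ⟨_ | n, a, v⟩
  · exact le_rfl
  · have h1 : T.arity v = 0 := ha
    have h2 : 0 < T.arity v := hq.2.2
    omega

theorem val_start (z : ℝ≥0) : val T X z (1, T.root, []) = gen T X z := by
  simp [val, T.prob_root, T.leafSum_nil, gen]

/-- The difference quotients of the generating function approach the expected leaf weight. -/
theorem exists_gen_add_le {d : ℝ≥0}
    (hd : (d : ℝ≥0∞) < ∑' v : T.leaves, (T.prob v : ℝ≥0∞) * (X v : ℝ≥0∞)) :
    ∃ z : ℝ≥0, z < 1 ∧ gen T X z + (1 - z : ℝ≥0) * d ≤ 1 := by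
  rw [ENNReal.tsum_eq_iSup_sum, lt_iSup_iff] at hd
  obtain ⟨s, hs⟩ := hd
  -- `φ z` is the finite part of `(1 - gen z) / (1 - z)`, with the quotient expanded as a geometric
  -- sum. Restricting to `s` makes it continuous at `1`, even if the full mean is infinite.
  let φ : ℝ≥0 → ℝ≥0 := fun z => ∑ v ∈ s, T.prob v * ∑ j ∈ Finset.range (X v), z ^ j
  have hφ : Continuous φ := by fun_prop
  have h1 : d < φ 1 := by
    have : (d : ℝ≥0∞) < (φ 1 : ℝ≥0) := by simpa [φ] using hs
    exact_mod_cast this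
  have hev : ∀ᶠ z in nhdsWithin (1 : ℝ≥0) (Set.Iio 1), d < φ z :=
    (hφ.continuousAt.eventually (lt_mem_nhds h1)).filter_mono nhdsWithin_le_nhds
  have : (nhdsWithin (1 : ℝ≥0) (Set.Iio 1)).NeBot :=
    nhdsLT_neBot_of_exists_lt ⟨0, zero_lt_one⟩
  obtain ⟨z, hz, hz1⟩ := (hev.and self_mem_nhdsWithin).exists
  have hz1 : z < 1 := hz1
  refine ⟨z, hz1, ?_⟩
  have hgeom : ∀ n : ℕ, z ^ n + (1 - z) * ∑ j ∈ Finset.range n, z ^ j = 1 := by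
    intro n
    induction n with
    | zero => simp
    | succ n ih =>
      rw [Finset.sum_range_succ, mul_add, ← add_assoc, add_right_comm, pow_succ']
      rw [← add_mul, add_tsub_cancel_of_le hz1.le, one_mul, ih]
  calc gen T X z + (1 - z : ℝ≥0) * d
      ≤ gen T X z + (1 - z : ℝ≥0) * φ z := by gcongr
    _ = gen T X z + ∑ v ∈ s, (T.prob v : ℝ≥0∞) *
          (((1 - z) * ∑ j ∈ Finset.range (X v), z ^ j : ℝ≥0) : ℝ≥0∞) := by
        congr 1
        simp only [φ]
        rw [ENNReal.ofNNReal_finsetSum, Finset.mul_sum]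
        refine Finset.sum_congr rfl fun v _ => ?_
        simp only [ENNReal.coe_mul]
        ring
    _ ≤ gen T X z + ∑' v : T.leaves, (T.prob v : ℝ≥0∞) *
          (((1 - z) * ∑ j ∈ Finset.range (X v), z ^ j : ℝ≥0) : ℝ≥0∞) := by
        gcongr
        exact ENNReal.sum_le_tsum s
    _ = T.termProb := by
        rw [gen, ← ENNReal.tsum_add]
        refine tsum_congr fun v => ?_
        rw [← mul_add, ← ENNReal.coe_pow, ← ENNReal.coe_add, hgeom, ENNReal.coe_one, mul_one]
    _ ≤ 1 := T.termProb_le_one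

end Replay

open Replay

variable {T : RST R} {X : List ℕ → ℕ} {Good : ℕ → A → Prop}

/-- A mean above some `d > 1` yields `z < 1` with `gen z ≤ z`, and the value of the start state,
`gen z`, bounds the termination probability of the replaying tree. -/
theorem not_isAST_of_replayable (hroot : 0 < T.arity [])
    (hemb : ∀ n a, Good (n + 1) a → ∃ e, Replayable T X Good n a e) (hgood : Good 1 T.root)
    (h : 1 < ∑' v : T.leaves, (T.prob v : ℝ≥0∞) * (X v : ℝ≥0∞)) : ¬ IsAST R := by
  classical
  intro hA
  have hemb' : ∀ n a, ∃ e, Good (n + 1) a → Replayable T X Good n a e := fun n a => by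
    by_cases hg : Good (n + 1) a
    · obtain ⟨e, he⟩ := hemb n a hg
      exact ⟨e, fun _ => he⟩
    · exact ⟨id, fun h => absurd h hg⟩
  choose emb hemb' using hemb'
  obtain ⟨d, hd1, hd⟩ := ENNReal.lt_iff_exists_nnreal_btwn.1 h
  have hd1 : 1 < d := by exact_mod_cast hd1
  obtain ⟨z, hz, hG⟩ := exists_gen_add_le T X hd
  have hGz : gen T X z ≤ z := by
    have h1 : gen T X z + (1 - z : ℝ≥0) ≤ z + (1 - z : ℝ≥0) := by
      rw [← ENNReal.coe_add, add_tsub_cancel_of_le hz.le]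
      refine le_trans ?_ hG
      gcongr
      refine le_mul_of_one_le_right' ?_
      exact_mod_cast hd1.le
    exact ENNReal.le_of_add_le_add_right ENNReal.coe_ne_top h1
  let S := strategy T X emb Good hroot hemb' hgood
  have hS := S.termProb_tree_le (val := val T X z)
    (fun q hq ha =>
      (sum_prob_mul_val_le T X emb hz.le (ε := 0) (by simpa using hGz) Good q hq ha).trans_eq
        (add_zero _))
    (fun q hq ha => one_le_val T X z Good q hq ha)
  rw [hA S.tree] at hS
  have hS' : (1 : ℝ≥0∞) ≤ z := hS.trans ((val_start T X z).le.trans hGz)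
  exact absurd hz (not_lt.2 (by exact_mod_cast hS'))

theorem not_isPAST_of_replayable (hroot : 0 < T.arity [])
    (hemb : ∀ n a, Good (n + 1) a → ∃ e, Replayable T X Good n a e) (hgood : Good 1 T.root)
    (h : 1 ≤ ∑' v : T.leaves, (T.prob v : ℝ≥0∞) * (X v : ℝ≥0∞)) : ¬ IsPAST R := by
  classical
  intro hP
  have hemb' : ∀ n a, ∃ e, Good (n + 1) a → Replayable T X Good n a e := fun n a => by
    by_cases hg : Good (n + 1) a
    · obtain ⟨e, he⟩ := hemb n a hg
      exact ⟨e, fun _ => he⟩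
    · exact ⟨id, fun h => absurd h hg⟩
  choose emb hemb' using hemb'
  let S := strategy T X emb Good hroot hemb' hgood
  have hT : 1 ≤ S.tree.termProb := by
    by_contra hlt
    exact S.tree.not_isPAST_of_termProb_lt (not_le.1 hlt) hP
  have hE := hP S.tree
  rw [RST.edl, if_neg (not_lt.2 hT)] at hE
  obtain ⟨E, hE'⟩ : ∃ E : ℝ≥0, (E : ℝ≥0∞) = _ := WithTop.ne_top_iff_exists.1 hE.ne
  -- Chosen so that `c * E + c < 1`: the term `c` pays for the excess of `gen z` over `z`, and `c *
  -- E` for the drift over `E` expected steps, both in units of `1 - z`.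
  set c : ℝ≥0 := 1 / (E + 2) with hc
  have hc1 : c < 1 := by
    rw [hc, div_lt_one (by positivity)]
    exact lt_of_lt_of_le one_lt_two le_add_self
  have hc0 : 0 < c := by positivity
  have hcE : c * E + c < 1 := by
    have h1 : c * (E + 2) = 1 := by rw [hc, one_div, inv_mul_cancel₀ (by positivity)]
    have h2 : c * E + c + c = 1 := by rw [← h1]; ring
    rw [← h2]
    exact lt_add_of_pos_right _ hc0
  obtain ⟨z, hz, hG⟩ := exists_gen_add_le T X (d := 1 - c) (lt_of_lt_of_le (by
    have : 1 - c < 1 := tsub_lt_self one_pos hc0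
    exact_mod_cast this) h)
  have hz0 : 0 < 1 - z := tsub_pos_of_lt hz
  have hGfin : gen T X z ≠ ⊤ := ne_top_of_le_ne_top ENNReal.one_ne_top (le_self_add.trans hG)
  obtain ⟨G, hGeq⟩ : ∃ G : ℝ≥0, (G : ℝ≥0∞) = _ := WithTop.ne_top_iff_exists.1 hGfin
  rw [← hGeq] at hG
  have hG : G + (1 - z) * (1 - c) ≤ 1 := by exact_mod_cast hG
  have hGz : G ≤ z + (1 - z) * c := by
    have h1 : G + (1 - z) * (1 - c) ≤ z + (1 - z) * c + (1 - z) * (1 - c) := by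
      refine hG.trans (le_of_eq ?_)
      rw [add_assoc, ← mul_add, add_tsub_cancel_of_le hc1.le, mul_one,
        add_tsub_cancel_of_le hz.le]
    exact le_of_add_le_add_right h1
  have hS := S.one_le_add_mul_tree_length hT (val := val T X z)
    (ε := (((1 - z) * c : ℝ≥0) : ℝ≥0∞))
    (fun q hq ha => sum_prob_mul_val_le T X emb hz.le
      (by rw [← hGeq]; exact_mod_cast hGz) Good q hq ha)
    (fun q hq ha => one_le_val T X z Good q hq ha)
  rw [← hE', show S.start = (1, T.root, []) from rfl, val_start, ← hGeq] at hS
  have hS : 1 ≤ G + (1 - z) * c * E := by exact_mod_cast hS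
  have hlt : z + (1 - z) * c + (1 - z) * c * E < 1 := by
    calc z + (1 - z) * c + (1 - z) * c * E = z + (1 - z) * (c * E + c) := by ring
      _ < z + (1 - z) * 1 := by gcongr
      _ = 1 := by rw [mul_one, add_tsub_cancel_of_le hz.le]
  exact absurd (hS.trans (by gcongr)) (not_le.2 hlt)

end Iterate

/-! ### Positions, substitutions and closure of rewriting -/

section Positions

variable {L : FirstOrder.Language.{u, v}} {V : Type w}

open FirstOrder.Language (Term)

@[simp]
theorem subtermAt_nil (t : L.Term V) : subtermAt t [] = some t := by
  cases t <;> rfl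

theorem subtermAt_append (s : L.Term V) (π ρ : List ℕ) :
    subtermAt s (π ++ ρ) = (subtermAt s π).bind fun u => subtermAt u ρ := by
  induction s generalizing π with
  | var x => cases π <;> simp [subtermAt]
  | @func l f ts ih =>
    cases π with
    | nil => simp
    | cons i π =>
      by_cases h : i < l
      · simp [subtermAt, h, ih]
      · simp [subtermAt, h]

theorem subtermAt_append_of_eq {s u : L.Term V} {π : List ℕ} (h : subtermAt s π = some u)
    (ρ : List ℕ) : subtermAt s (π ++ ρ) = subtermAt u ρ := by
  rw [subtermAt_append, h, Option.bind_some]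

theorem subtermAt_subst {r u : L.Term V} {ρ : List ℕ} (h : subtermAt r ρ = some u)
    (σ : V → L.Term V) : subtermAt (r.subst σ) ρ = some (u.subst σ) := by
  induction r generalizing ρ with
  | var x =>
    cases ρ with
    | nil => simp only [subtermAt_nil, Option.some.injEq] at h ⊢; rw [h]
    | cons i ρ => simp [subtermAt] at h
  | @func l f ts ih =>
    cases ρ with
    | nil => simp only [subtermAt_nil, Option.some.injEq] at h ⊢; rw [h]
    | cons i ρ =>
      by_cases hi : i < l
      · simp only [subtermAt, hi, dif_pos, FirstOrder.Language.Term.subst] at h ⊢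
        exact ih _ h
      · simp [subtermAt, hi] at h

theorem isFunPos_or_of_subtermAt_subst {r u : L.Term V} {σ : V → L.Term V} {ρ : List ℕ}
    (h : subtermAt (r.subst σ) ρ = some u) :
    IsFunPos r ρ ∨ ∃ q x τ, subtermAt r q = some (.var x) ∧ ρ = q ++ τ := by
  induction r generalizing ρ with
  | var x => exact Or.inr ⟨[], x, ρ, by simp, rfl⟩
  | @func l f ts ih =>
    cases ρ with
    | nil => exact Or.inl ⟨l, f, ts, by simp⟩
    | cons i ρ =>
      by_cases hi : i < l
      · simp only [subtermAt, hi, dif_pos, FirstOrder.Language.Term.subst] at h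
        rcases ih _ h with ⟨l', f', ts', h'⟩ | ⟨q, x, τ, h', rfl⟩
        · exact Or.inl ⟨l', f', ts', by simpa [subtermAt, hi] using h'⟩
        · exact Or.inr ⟨i :: q, x, τ, by simpa [subtermAt, hi] using h', rfl⟩
      · simp [subtermAt, hi, FirstOrder.Language.Term.subst] at h

theorem not_isFunPos_append {r : L.Term V} {q : List ℕ} {x : V} (h : subtermAt r q = some (.var x))
    (τ : List ℕ) : ¬ IsFunPos r (q ++ τ) := by
  rintro ⟨l, f, ts, h'⟩
  rw [subtermAt_append_of_eq h] at h'
  cases τ <;> simp [subtermAt] at h'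

theorem IsFunPos.append {r u : L.Term V} {ρ τ : List ℕ} (h : subtermAt r ρ = some u)
    (hτ : IsFunPos u τ) : IsFunPos r (ρ ++ τ) := by
  obtain ⟨l, f, ts, h'⟩ := hτ
  exact ⟨l, f, ts, by rw [subtermAt_append_of_eq h, h']⟩

theorem IsFunPos.subst {t : L.Term V} {τ : List ℕ} (h : IsFunPos t τ) (σ : V → L.Term V) :
    IsFunPos (t.subst σ) τ := by
  obtain ⟨l, f, ts, h⟩ := h
  exact ⟨l, f, _, subtermAt_subst h σ⟩

theorem subtermAt_replaceAt {s : L.Term V} {π : List ℕ} (hπ : π ∈ positions s) (r : L.Term V)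
    (ρ : List ℕ) : subtermAt (replaceAt s π r) (π ++ ρ) = subtermAt r ρ := by
  rw [mem_positions_iff] at hπ
  induction s generalizing π with
  | var x => cases π with
    | nil => simp [replaceAt]
    | cons i π => simp [subtermAt] at hπ
  | @func l f ts ih =>
    cases π with
    | nil => simp [replaceAt]
    | cons i π =>
      by_cases hi : i < l
      · simp only [subtermAt, hi, dif_pos] at hπ
        simpa [replaceAt, subtermAt, hi] using ih _ hπ
      · simp [subtermAt, hi] at hπ

theorem subtermAt_replaceAt_of_parallel (s r : L.Term V) {π ρ : List ℕ} (h1 : ¬ π <+: ρ)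
    (h2 : ¬ ρ <+: π) : subtermAt (replaceAt s π r) ρ = subtermAt s ρ := by
  induction s generalizing π ρ with
  | var x => cases π with
    | nil => exact absurd (List.nil_prefix) h1
    | cons i π => rfl
  | @func l f ts ih =>
    cases π with
    | nil => exact absurd (List.nil_prefix) h1
    | cons i π =>
      cases ρ with
      | nil => exact absurd (List.nil_prefix) h2
      | cons j ρ =>
        by_cases hj : j < l
        · simp only [replaceAt, subtermAt, hj, dif_pos]
          split_ifs with hij
          · subst hij
            exact ih _ (fun h => h1 (List.cons_prefix_cons.2 ⟨rfl, h⟩))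
              (fun h => h2 (List.cons_prefix_cons.2 ⟨rfl, h⟩))
          · rfl
        · simp [replaceAt, subtermAt, hj]

theorem replaceAt_subst {a : L.Term V} {π : List ℕ} (hπ : π ∈ positions a) (r : L.Term V)
    (σ : V → L.Term V) : (replaceAt a π r).subst σ = replaceAt (a.subst σ) π (r.subst σ) := by
  rw [mem_positions_iff] at hπ
  induction a generalizing π with
  | var x => cases π with
    | nil => simp [replaceAt]
    | cons i π => simp [subtermAt] at hπ
  | @func l f ts ih =>
    cases π with
    | nil => simp [replaceAt]
    | cons i π =>
      by_cases hi : i < l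
      · simp only [subtermAt, hi, dif_pos] at hπ
        simp only [replaceAt, FirstOrder.Language.Term.subst, FirstOrder.Language.Term.func.injEq,
          heq_eq_eq, true_and]
        funext j
        split_ifs with hj
        · subst hj
          exact ih _ hπ
        · rfl
      · simp [subtermAt, hi] at hπ

theorem replaceAt_replaceAt (s r r' : L.Term V) (π ρ : List ℕ) :
    replaceAt (replaceAt s π r) (π ++ ρ) r' = replaceAt s π (replaceAt r ρ r') ∨
      π ∉ positions s := by
  rw [mem_positions_iff]
  induction s generalizing π with
  | var x => cases π with
    | nil => simp [replaceAt]
    | cons i π => simp [subtermAt]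
  | @func l f ts ih =>
    cases π with
    | nil => simp [replaceAt]
    | cons i π =>
      by_cases hi : i < l
      · rcases ih ⟨i, hi⟩ π with h | h
        · left
          simp only [List.cons_append, replaceAt, FirstOrder.Language.Term.func.injEq,
            heq_eq_eq, true_and]
          funext j
          split_ifs with hj
          · subst hj
            exact h
          · rfl
        · right
          simpa [subtermAt, hi] using h
      · right
        simp [subtermAt, hi]

theorem replaceAt_self {s u : L.Term V} {π : List ℕ} (h : subtermAt s π = some u) :
    replaceAt s π u = s := by
  induction s generalizing π with
  | var x => cases π with
    | nil => simpa [replaceAt] using h.symm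
    | cons i π => simp [subtermAt] at h
  | @func l f ts ih =>
    cases π with
    | nil => simpa [replaceAt] using h.symm
    | cons i π =>
      by_cases hi : i < l
      · simp only [subtermAt, hi, dif_pos] at h
        simp only [replaceAt, FirstOrder.Language.Term.func.injEq, heq_eq_eq, true_and]
        funext j
        split_ifs with hj
        · subst hj
          exact ih _ h
        · rfl
      · simp [subtermAt, hi] at h

theorem subst_subst (t : L.Term V) (σ τ : V → L.Term V) :
    (t.subst σ).subst τ = t.subst fun x => (σ x).subst τ := by
  induction t with
  | var x => rfl
  | func f ts ih => simp only [FirstOrder.Language.Term.subst, ih]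

theorem IsSubst.comp {σ τ : V → L.Term V} (hσ : IsSubst σ) (hτ : IsSubst τ) :
    IsSubst fun x => (σ x).subst τ := by
  refine (hσ.union hτ).subset fun x hx => ?_
  by_contra h
  simp only [Set.mem_union, Set.mem_ofPred_eq, not_or, not_not] at h
  refine hx ?_
  simp only [h.1, FirstOrder.Language.Term.subst, h.2]

theorem isSubst_var : IsSubst (fun x : V => (.var x : L.Term V)) := by
  simp [IsSubst]

theorem subst_var (t : L.Term V) : t.subst (fun x => .var x) = t := by
  induction t with
  | var x => rfl
  | func f ts ih => simp only [FirstOrder.Language.Term.subst, ih]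

/-- The redex moves to `π ++ π'` and its matching substitution is composed with `σ`. -/
theorem rewrites_replaceAt_subst {P : PTRS L V} {s : L.Term V} {π : List ℕ}
    (hπ : π ∈ positions s) {σ : V → L.Term V} (hσ : IsSubst σ) {a : L.Term V}
    {μ : FDist (L.Term V)} (h : P.rewrites a μ) :
    P.rewrites (replaceAt s π (a.subst σ)) (μ.map fun r => replaceAt s π (r.subst σ)) := by
  obtain ⟨π', hπ', ρ, hρ, σ', hσ', hs, rfl⟩ := h
  have hs' : subtermAt (replaceAt s π (a.subst σ)) (π ++ π') =
      some (ρ.lhs.subst fun x => (σ' x).subst σ) := by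
    rw [subtermAt_replaceAt hπ, subtermAt_subst hs, subst_subst]
  refine ⟨π ++ π', ?_, ρ, hρ, _, hσ'.comp hσ, hs', ?_⟩
  · rw [mem_positions_iff, hs']
    rfl
  · simp only [FDist.map, Multiset.map_map, FDist.mk.injEq]
    refine Multiset.map_congr rfl fun q _ => ?_
    simp only [Function.comp, Prod.mk.injEq, true_and]
    rw [(replaceAt_replaceAt _ _ _ _ _).resolve_right (not_not.2 hπ), replaceAt_subst hπ',
      subst_subst]

end Positions

/-! ### Counting non-overlapping occurrences -/

section Counting

variable {L : FirstOrder.Language.{u, v}} {V : Type w}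

/-- The sum of the weights of all variable occurrences of a term. -/
def varWeight (c : V → ℕ) : L.Term V → ℕ
  | .var x => c x
  | .func _ ts => ∑ i, varWeight c (ts i)

theorem varWeight_eq_sum [DecidableEq V] (c : V → ℕ) (t : L.Term V) {F : Finset V}
    (hF : t.varFinset ⊆ F) : varWeight c t = ∑ x ∈ F, varCount x t * c x := by
  induction t with
  | var y =>
    have hy : y ∈ F := hF (by simp [FirstOrder.Language.Term.varFinset])
    rw [Finset.sum_eq_single y]
    · simp [varWeight, varCount]
    · intro x _ hx
      simp [varCount, hx.symm]
    · exact fun h => absurd hy h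
  | func f ts ih =>
    have hts : ∀ i, (ts i).varFinset ⊆ F := fun i =>
      (Finset.subset_biUnion_of_mem (fun i => (ts i).varFinset) (Finset.mem_univ i)).trans hF
    simp only [varWeight, varCount, Finset.sum_mul]
    rw [Finset.sum_comm]
    exact Finset.sum_congr rfl fun i _ => ih i (hts i)

/-- The weight is `∑ x, varCount x * c x`. Through this monotonicity the non-variable-decreasing
hypothesis enters. -/
theorem varWeight_mono (c : V → ℕ) {t r : L.Term V} (h : ∀ x, varCount x t ≤ varCount x r) :
    varWeight c t ≤ varWeight c r := by
  classical
  rw [varWeight_eq_sum c t (Finset.subset_union_left (s₂ := r.varFinset)),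
    varWeight_eq_sum c r (Finset.subset_union_right (s₁ := t.varFinset))]
  exact Finset.sum_le_sum fun x _ => Nat.mul_le_mul_right _ (h x)

/-- The positions `q ++ τ` where `q` is the position of a variable `x` and `τ ∈ W x`. -/
def varPositions (W : V → Finset (List ℕ)) : L.Term V → Finset (List ℕ)
  | .var x => W x
  | .func _ ts => Finset.univ.biUnion fun i => (varPositions W (ts i)).image fun π => i.val :: π

theorem mem_varPositions {W : V → Finset (List ℕ)} {r : L.Term V} {ρ : List ℕ} :
    ρ ∈ varPositions W r ↔ ∃ q x τ, subtermAt r q = some (.var x) ∧ τ ∈ W x ∧ ρ = q ++ τ := by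
  induction r generalizing ρ with
  | var x =>
    constructor
    · exact fun h => ⟨[], x, ρ, by simp, h, rfl⟩
    · rintro ⟨_ | ⟨i, q⟩, y, τ, h, hτ, rfl⟩
      · simp only [subtermAt_nil, Option.some.injEq, FirstOrder.Language.Term.var.injEq] at h
        subst h
        exact hτ
      · simp [subtermAt] at h
  | @func l f ts ih =>
    simp only [varPositions, Finset.mem_biUnion, Finset.mem_univ, true_and, Finset.mem_image, ih]
    constructor
    · rintro ⟨i, _, ⟨q, x, τ, h, hτ, rfl⟩, rfl⟩
      exact ⟨i :: q, x, τ, by simpa [subtermAt] using h, hτ, rfl⟩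
    · rintro ⟨_ | ⟨i, q⟩, x, τ, h, hτ, rfl⟩
      · simp at h
      · by_cases hi : i < l
        · simp only [subtermAt, hi, dif_pos] at h
          exact ⟨⟨i, hi⟩, _, ⟨q, x, τ, h, hτ, rfl⟩, rfl⟩
        · simp [subtermAt, hi] at h

theorem card_varPositions (W : V → Finset (List ℕ)) (r : L.Term V) :
    (varPositions W r).card = varWeight (fun x => (W x).card) r := by
  induction r with
  | var x => rfl
  | @func l f ts ih =>
    simp only [varPositions, varWeight]
    rw [Finset.card_biUnion]
    · refine Finset.sum_congr rfl fun i _ => ?_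
      rw [Finset.card_image_of_injective _ (List.cons_injective), ih]
    · intro i _ j _ hij
      rw [Function.onFun, Finset.disjoint_left]
      intro ρ hi hj
      obtain ⟨a, -, rfl⟩ := Finset.mem_image.1 hi
      obtain ⟨b, -, hb⟩ := Finset.mem_image.1 hj
      exact hij (Fin.ext (List.cons.inj hb).1.symm)

theorem card_le_varWeight {c : V → ℕ} {t : L.Term V} {B : Finset (List ℕ)}
    (hB : ∀ ρ ∈ B, ∃ q x τ, subtermAt t q = some (.var x) ∧ ρ = q ++ τ)
    (hc : ∀ (q : List ℕ) (x : V) (C : Finset (List ℕ)), subtermAt t q = some (.var x) →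
      (∀ τ ∈ C, q ++ τ ∈ B) → C.card ≤ c x) : B.card ≤ varWeight c t := by
  classical
  induction t generalizing B with
  | var x => exact hc [] x B (by simp) (by simp)
  | @func l f ts ih =>
    let D : Fin l → Finset (List ℕ) := fun i =>
      B.preimage (List.cons i.val) List.cons_injective.injOn
    have hsub : B ⊆ Finset.univ.biUnion fun i => (D i).image (List.cons i.val) := by
      intro ρ hρ
      obtain ⟨_ | ⟨i, q⟩, x, τ, h, rfl⟩ := hB ρ hρ
      · simp at h
      · by_cases hi : i < l
        · refine Finset.mem_biUnion.2 ⟨⟨i, hi⟩, Finset.mem_univ _,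
            Finset.mem_image.2 ⟨q ++ τ, ?_, rfl⟩⟩
          exact Finset.mem_preimage.2 hρ
        · simp [subtermAt, hi] at h
    refine (Finset.card_le_card hsub).trans (Finset.card_biUnion_le.trans ?_)
    refine Finset.sum_le_sum fun i _ => Finset.card_image_le.trans (ih i ?_ ?_)
    · intro ρ hρ
      obtain ⟨_ | ⟨j, q⟩, x, τ, h, he⟩ := hB _ (Finset.mem_preimage.1 hρ)
      · simp at h
      · obtain ⟨rfl, rfl⟩ := List.cons.inj he
        exact ⟨q, x, τ, by simpa [subtermAt] using h, rfl⟩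
    · intro q x C h hC
      exact hc (i :: q) x C (by simpa [subtermAt] using h) fun τ hτ => by
        simpa [D] using hC τ hτ

theorem overlapping_append_iff (t : L.Term V) (q a b : List ℕ) :
    Overlapping t (q ++ a) (q ++ b) ↔ Overlapping t a b := by
  simp only [Overlapping, List.append_assoc, List.append_cancel_left_eq]

theorem Overlapping.symm {t : L.Term V} {a b : List ℕ} (h : Overlapping t a b) :
    Overlapping t b a := by
  obtain ⟨τ, hτ, h⟩ := h
  exact ⟨τ, hτ, h.symm⟩

theorem Overlapping.prefix_or_prefix {t : L.Term V} {a b : List ℕ} (h : Overlapping t a b) :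
    b <+: a ∨ a <+: b := by
  obtain ⟨τ, -, rfl | rfl⟩ := h
  · exact Or.inl (List.prefix_append _ _)
  · exact Or.inr (List.prefix_append _ _)

theorem OccursAt.subst {t r : L.Term V} {ρ : List ℕ} (h : OccursAt t r ρ) {σ : V → L.Term V}
    (hσ : IsSubst σ) : OccursAt t (r.subst σ) ρ := by
  obtain ⟨δ, hδ, h⟩ := h
  exact ⟨_, hδ.comp hσ, by rw [subtermAt_subst h, subst_subst]⟩

theorem occursAt_append {t s u : L.Term V} {π : List ℕ} (h : subtermAt s π = some u)
    (ρ : List ℕ) : OccursAt t s (π ++ ρ) ↔ OccursAt t u ρ := by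
  simp only [OccursAt, subtermAt_append_of_eq h]

theorem OccursAt.isFunPos_append {t s : L.Term V} {ρ τ : List ℕ} (h : OccursAt t s ρ)
    (hτ : IsFunPos t τ) : IsFunPos s (ρ ++ τ) := by
  obtain ⟨δ, -, h⟩ := h
  exact (hτ.subst δ).append h

theorem card_le_maxNO {t s : L.Term V} {S : Finset (List ℕ)} (h : ∀ π ∈ S, OccursAt t s π)
    (hS : ∀ π₁ ∈ S, ∀ π₂ ∈ S, π₁ ≠ π₂ → ¬ Overlapping t π₁ π₂) : S.card ≤ maxNO t s := by
  refine (isGreatest_maxNO t s).2 ⟨S, ⟨fun π hπ => ?_, h, hS⟩, rfl⟩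
  obtain ⟨σ, -, hs⟩ := h π hπ
  rw [mem_positions_iff, hs]
  rfl

theorem exists_card_eq_maxNO (t s : L.Term V) :
    ∃ S : Finset (List ℕ), S.card = maxNO t s ∧ (∀ π ∈ S, OccursAt t s π) ∧
      ∀ π₁ ∈ S, ∀ π₂ ∈ S, π₁ ≠ π₂ → ¬ Overlapping t π₁ π₂ := by
  obtain ⟨S, hS, h⟩ := (isGreatest_maxNO t s).1
  exact ⟨S, h, hS.2.1, hS.2.2⟩

theorem one_le_maxNO_self (t : L.Term V) : 1 ≤ maxNO t t := by
  have := card_le_maxNO (t := t) (s := t) (S := {[]})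
    (by simpa using ⟨_, isSubst_var, by rw [subst_var, subtermAt_nil]⟩) (by simp)
  simpa using this

/-- Optimal sets for `r` and for each copy of each `σ x` can be united: an occurrence in `r` covers
function positions of `r` only, while those in the copies start at or below variable positions, and
distinct variable positions are parallel. -/
theorem maxNO_add_varWeight_le {t : L.Term V} (ht : IsFunPos t []) (r : L.Term V)
    {σ : V → L.Term V} (hσ : IsSubst σ) :
    maxNO t r + varWeight (fun x => maxNO t (σ x)) r ≤ maxNO t (r.subst σ) := by
  classical
  obtain ⟨N, hN, hNocc, hNno⟩ := exists_card_eq_maxNO t r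
  choose W hW hWocc hWno using fun x => exists_card_eq_maxNO t (σ x)
  have hsep : ∀ ρ ∈ N, ∀ q x, subtermAt r q = some (.var x) → ¬ q <+: ρ := by
    rintro ρ hρ q x hq ⟨ρ', rfl⟩
    refine not_isFunPos_append hq ρ' ?_
    simpa using (hNocc _ hρ).isFunPos_append ht
  have hmix : ∀ ρ ∈ N, ∀ q x τ, subtermAt r q = some (.var x) →
      ¬ Overlapping t ρ (q ++ τ) := by
    rintro ρ hρ q x τ hq ⟨τ', hτ', h | h⟩
    · exact hsep ρ hρ q x hq ⟨τ ++ τ', by rw [h, List.append_assoc]⟩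
    · refine not_isFunPos_append hq τ ?_
      rw [h]
      exact (hNocc _ hρ).isFunPos_append hτ'
  have hdisj : Disjoint N (varPositions W r) := by
    rw [Finset.disjoint_left]
    intro ρ hρ hρ'
    obtain ⟨q, x, τ, hq, -, rfl⟩ := mem_varPositions.1 hρ'
    exact hsep _ hρ q x hq (List.prefix_append _ _)
  have hcard : (N ∪ varPositions W r).card =
      maxNO t r + varWeight (fun x => maxNO t (σ x)) r := by
    rw [Finset.card_union_of_disjoint hdisj, hN, card_varPositions]
    simp only [hW]
  rw [← hcard]
  refine card_le_maxNO (fun ρ hρ => ?_) (fun a ha b hb hab => ?_)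
  · rcases Finset.mem_union.1 hρ with h | h
    · exact (hNocc ρ h).subst hσ
    · obtain ⟨q, x, τ, hq, hτ, rfl⟩ := mem_varPositions.1 h
      exact (occursAt_append (subtermAt_subst hq σ) τ).2 (hWocc x τ hτ)
  · rcases Finset.mem_union.1 ha with ha | ha <;> rcases Finset.mem_union.1 hb with hb | hb
    · exact hNno a ha b hb hab
    · obtain ⟨q, x, τ, hq, -, rfl⟩ := mem_varPositions.1 hb
      exact hmix a ha q x τ hq
    · obtain ⟨q, x, τ, hq, -, rfl⟩ := mem_varPositions.1 ha
      exact fun h => hmix b hb q x τ hq h.symm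
    · obtain ⟨q, x, τ, hq, hτ, rfl⟩ := mem_varPositions.1 ha
      obtain ⟨q', x', τ', hq', hτ', rfl⟩ := mem_varPositions.1 hb
      intro hov
      have hqq : q = q' := by
        have hpre : q <+: q' ∨ q' <+: q := by
          rcases hov.prefix_or_prefix with h | h
          · exact List.prefix_or_prefix_of_prefix
              (List.prefix_append q τ) ((List.prefix_append q' τ').trans h)
          · exact List.prefix_or_prefix_of_prefix
              ((List.prefix_append q τ).trans h) (List.prefix_append q' τ')
        rcases hpre with ⟨ρ, rfl⟩ | ⟨ρ, rfl⟩
        · rw [subtermAt_append_of_eq hq] at hq'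
          cases ρ with
          | nil => simp
          | cons i ρ => simp [subtermAt] at hq'
        · rw [subtermAt_append_of_eq hq'] at hq
          cases ρ with
          | nil => simp
          | cons i ρ => simp [subtermAt] at hq
      subst hqq
      rw [hq] at hq'
      simp only [Option.some.injEq, FirstOrder.Language.Term.var.injEq] at hq'
      subst hq'
      exact hWno x τ hτ τ' hτ' (fun h => hab (by rw [h])) ((overlapping_append_iff t q τ τ').1 hov)

/-- Outside the function positions of `t` every position lies in the copy of some `σ x`, and each
copy holds at most `maxNO t (σ x)` members of `B`. -/
theorem card_le_varWeight_maxNO {t : L.Term V} {σ : V → L.Term V} {B : Finset (List ℕ)}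
    (hocc : ∀ ρ ∈ B, OccursAt t (t.subst σ) ρ) (hfun : ∀ ρ ∈ B, ¬ IsFunPos t ρ)
    (hno : ∀ a ∈ B, ∀ b ∈ B, a ≠ b → ¬ Overlapping t a b) :
    B.card ≤ varWeight (fun x => maxNO t (σ x)) t := by
  refine card_le_varWeight (fun ρ hρ => ?_) fun q x C hq hC => ?_
  · obtain ⟨δ, -, h⟩ := hocc ρ hρ
    exact (isFunPos_or_of_subtermAt_subst h).resolve_left (hfun ρ hρ)
  · refine card_le_maxNO (fun τ hτ => ?_) fun a ha b hb hab hov => ?_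
    · exact (occursAt_append (subtermAt_subst hq σ) τ).1 (hocc _ (hC τ hτ))
    · exact hno _ (hC a ha) _ (hC b hb) (fun h => hab (List.append_cancel_left h))
        ((overlapping_append_iff t q a b).2 hov)

/-- Among the occurrences of `t` in `s` there is one at which `t` can be replaced by any term with
as many variables, such that only this occurrence is lost. -/
theorem exists_occurrence_replaceAt {t : L.Term V} (ht : IsFunPos t []) {s : L.Term V} {n : ℕ}
    (hn : n + 1 ≤ maxNO t s) :
    ∃ π ∈ positions s, ∃ σ : V → L.Term V, IsSubst σ ∧ subtermAt s π = some (t.subst σ) ∧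
      ∀ r : L.Term V, (∀ x, varCount x t ≤ varCount x r) →
        n + maxNO t r ≤ maxNO t (replaceAt s π (r.subst σ)) := by
  classical
  obtain ⟨S, hS, hocc, hno⟩ := exists_card_eq_maxNO t s
  -- By minimal length no other member of `S` lies above `π`. For non-linear `t`, a replacement
  -- inside the substitution part of an occurrence could destroy its match.
  obtain ⟨π, hπS, hmin⟩ := S.exists_min_image List.length (Finset.card_pos.1 (by omega))
  obtain ⟨σ, hσ, hsub⟩ := hocc π hπS
  have hπ : π ∈ positions s := by
    rw [mem_positions_iff, hsub]
    rfl
  refine ⟨π, hπ, σ, hσ, hsub, fun r hr => ?_⟩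
  set S₁ := (S.erase π).filter fun ρ => π <+: ρ with hS₁
  set S₂ := (S.erase π).filter fun ρ => ¬ π <+: ρ with hS₂
  have hcard : S₁.card + S₂.card + 1 = maxNO t s := by
    rw [hS₁, hS₂, Finset.card_filter_add_card_filter_not, Finset.card_erase_add_one hπS, hS]
  have hpar : ∀ ρ ∈ S₂, ρ ∈ S ∧ ¬ π <+: ρ ∧ ¬ ρ <+: π := by
    intro ρ hρ
    obtain ⟨hρ, hnp⟩ := Finset.mem_filter.1 hρ
    have hρS := Finset.mem_of_mem_erase hρ
    exact ⟨hρS, hnp, fun h => Finset.ne_of_mem_erase hρ (h.eq_of_length_le (hmin ρ hρS))⟩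
  -- Members of `S` strictly below `π` do not overlap `π`, so they lie in the substitution part of
  -- the occurrence at `π`.
  have hS₁card : S₁.card ≤ varWeight (fun x => maxNO t (σ x)) t := by
    let B := S₁.preimage (fun ρ => π ++ ρ) (List.append_right_injective π).injOn
    have hBS : ∀ ρ ∈ B, π ++ ρ ∈ S ∧ π ++ ρ ≠ π := fun ρ hρ => by
      have h := (Finset.mem_filter.1 (Finset.mem_preimage.1 hρ)).1
      exact ⟨Finset.mem_of_mem_erase h, Finset.ne_of_mem_erase h⟩
    have hle : S₁.card ≤ B.card := by
      refine (Finset.card_le_card fun ρ hρ => ?_).trans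
        (Finset.card_image_le (s := B) (f := fun ρ => π ++ ρ))
      obtain ⟨τ, rfl⟩ := (Finset.mem_filter.1 hρ).2
      exact Finset.mem_image.2 ⟨τ, Finset.mem_preimage.2 hρ, rfl⟩
    refine hle.trans (card_le_varWeight_maxNO (fun ρ hρ => ?_) (fun ρ hρ hf => ?_)
      fun a ha b hb hab hov => ?_)
    · exact (occursAt_append hsub ρ).1 (hocc _ (hBS ρ hρ).1)
    · exact hno _ (hBS ρ hρ).1 _ hπS (hBS ρ hρ).2 ⟨ρ, hf, Or.inl rfl⟩
    · exact hno _ (hBS a ha).1 _ (hBS b hb).1 (fun h => hab (List.append_cancel_left h))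
        ((overlapping_append_iff t π a b).2 hov)
  obtain ⟨M, hM, hMocc, hMno⟩ := exists_card_eq_maxNO t (r.subst σ)
  -- The occurrences in `S₁` may all vanish, but the copies of `σ x` in `r.subst σ` supply at least
  -- as many.
  have hMcard : maxNO t r + S₁.card ≤ M.card := by
    rw [hM]
    have := varWeight_mono (fun x => maxNO t (σ x)) hr
    have := maxNO_add_varWeight_le ht r hσ
    omega
  have hdisj : Disjoint S₂ (M.image fun ρ => π ++ ρ) := by
    rw [Finset.disjoint_left]
    intro ρ hρ hρ'
    obtain ⟨τ, -, rfl⟩ := Finset.mem_image.1 hρ'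
    exact (hpar _ hρ).2.1 (List.prefix_append _ _)
  have hU : S₂.card + M.card = (S₂ ∪ M.image fun ρ => π ++ ρ).card := by
    rw [Finset.card_union_of_disjoint hdisj,
      Finset.card_image_of_injective _ (List.append_right_injective π)]
  have hmix : ∀ ρ ∈ S₂, ∀ τ, ¬ Overlapping t ρ (π ++ τ) := by
    intro ρ hρ τ hov
    obtain ⟨-, h1, h2⟩ := hpar ρ hρ
    rcases hov.prefix_or_prefix with h | h
    · exact h1 ((List.prefix_append _ _).trans h)
    · exact (List.prefix_or_prefix_of_prefix h (List.prefix_append π τ)).elim h2 h1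
  have hle : (S₂ ∪ M.image fun ρ => π ++ ρ).card ≤ maxNO t (replaceAt s π (r.subst σ)) := by
    refine card_le_maxNO (fun ρ hρ => ?_) fun a ha b hb hab => ?_
    · rcases Finset.mem_union.1 hρ with h | h
      · obtain ⟨hρS, h1, h2⟩ := hpar ρ h
        obtain ⟨δ, hδ, hs⟩ := hocc ρ hρS
        exact ⟨δ, hδ, by rw [subtermAt_replaceAt_of_parallel _ _ h1 h2, hs]⟩
      · obtain ⟨τ, hτ, rfl⟩ := Finset.mem_image.1 h
        obtain ⟨δ, hδ, hs⟩ := hMocc τ hτ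
        exact ⟨δ, hδ, by rw [subtermAt_replaceAt hπ, hs]⟩
    · rcases Finset.mem_union.1 ha with ha | ha <;> rcases Finset.mem_union.1 hb with hb | hb
      · exact hno a (hpar a ha).1 b (hpar b hb).1 hab
      · obtain ⟨τ, -, rfl⟩ := Finset.mem_image.1 hb
        exact hmix a ha τ
      · obtain ⟨τ, -, rfl⟩ := Finset.mem_image.1 ha
        exact fun h => hmix b hb τ h.symm
      · obtain ⟨τ, hτ, rfl⟩ := Finset.mem_image.1 ha
        obtain ⟨τ', hτ', rfl⟩ := Finset.mem_image.1 hb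
        rw [overlapping_append_iff]
        exact hMno τ hτ τ' hτ' fun h => hab (by rw [h])
  omega

end Counting

/-! ### Replaying inside terms -/

section Embedding

variable {L : FirstOrder.Language.{u, v}} {V : Type w}

theorem RST.arity_nil_pos {A : Type*} {R : PARS A} {T : RST R} (h : 0 < T.height) :
    0 < T.arity [] := by
  obtain ⟨⟨v, hv⟩, hlt⟩ := lt_iSup_iff.1 h
  rcases List.eq_nil_or_concat v with rfl | ⟨l, i, rfl⟩
  · simp at hlt
  · have hi : [i] ∈ T.nodes := T.mem_nodes_of_suffix ⟨l, by simp⟩ hv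
    have := ((T.cons_mem_iff i []).1 hi).2
    omega

/-- A variable has no redex because left-hand sides are not variables. Positive height thus ensures
that the root term starts with a function symbol. -/
theorem isFunPos_nil_of_rewrites {P : PTRS L V} {s : L.Term V} {μ : FDist (L.Term V)}
    (h : P.rewrites s μ) : IsFunPos s [] := by
  obtain ⟨π, hπ, ρ, -, σ, -, hs, -⟩ := h
  cases s with
  | func f ts => exact ⟨_, f, ts, subtermAt_nil _⟩
  | var x =>
    exfalso
    cases π with
    | nil =>
      rw [subtermAt_nil, Option.some.injEq] at hs
      cases hl : ρ.lhs with
      | var y => exact ρ.lhs_ne_var y hl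
      | func f ts =>
        rw [hl] at hs
        exact absurd hs (by simp [FirstOrder.Language.Term.subst])
    | cons i π => simp [subtermAt] at hs

theorem exists_replayable {P : PTRS L V} {T : RST P.rewrites} (hnvd : IsNVD T)
    (ht : IsFunPos T.root []) (n : ℕ) (a : L.Term V) (h : n + 1 ≤ maxNO T.root a) :
    ∃ e, Replayable T (fun v => maxNO T.root (T.obj v)) (fun n a => n ≤ maxNO T.root a) n a e := by
  obtain ⟨π, hπ, σ, hσ, hs, hr⟩ := exists_occurrence_replaceAt ht h
  exact ⟨fun r => replaceAt a π (r.subst σ),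
    fun _ _ hR => rewrites_replaceAt_subst hπ hσ hR, replaceAt_self hs,
    fun v hv => hr _ (hnvd v hv)⟩

end Embedding

end ProbRewriting

theorem mainTheorem3 {L : FirstOrder.Language.{u, v}} {V : Type w}
    (P : ProbRewriting.PTRS L V) (T : ProbRewriting.RST P.rewrites)
    (hnvd : ProbRewriting.IsNVD T) (hheight : 0 < T.height) :
    ((1 < ∑' v : T.leaves,
        (T.prob v : ℝ≥0∞) * (ProbRewriting.maxNO T.root (T.obj v) : ℝ≥0∞)) →
      ¬ ProbRewriting.IsAST P.rewrites) ∧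
    ((1 ≤ ∑' v : T.leaves,
        (T.prob v : ℝ≥0∞) * (ProbRewriting.maxNO T.root (T.obj v) : ℝ≥0∞)) →
      ¬ ProbRewriting.IsPAST P.rewrites) := by
  have hroot := ProbRewriting.RST.arity_nil_pos hheight
  obtain ⟨μ, hμ, -⟩ := T.step [] T.root_mem hroot
  have hemb := ProbRewriting.exists_replayable hnvd (ProbRewriting.isFunPos_nil_of_rewrites hμ)
  have hgood := ProbRewriting.one_le_maxNO_self T.root
  constructor
  · exact ProbRewriting.not_isAST_of_replayable (X := fun v => ProbRewriting.maxNO T.root (T.obj v))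
      (Good := fun n a => n ≤ ProbRewriting.maxNO T.root a) hroot hemb hgood
  · exact ProbRewriting.not_isPAST_of_replayable
      (X := fun v => ProbRewriting.maxNO T.root (T.obj v))
      (Good := fun n a => n ≤ ProbRewriting.maxNO T.root a) hroot hemb hgood
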